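/- Let $k$ be a commutative ring and let $\mathcal{T}$ be a class of finite groups closed under taking subquotients (that is, if $G\in\mathcal{T}$, $A\trianglelefteq B\leq G$ and $H\cong B/A$, then $H\in\mathcal{T}$). For finite groups $G,H$, let $B(H,G)$ be the Burnside group of finite $(H,G)$-bisets (sets with commuting left $H$-action and right $G$-action), i.e. the free abelian group on isomorphism classes of finite $(H,G)$-bisets modulo the relations $[X\sqcup Y]=[X]+[Y]$, and let $kB(H,G)=k\otimes_{\mathbb{Z}}B(H,G)$. Let $k\mathcal{T}$ be the category whose objects are the groups in $\mathcal{T}$, with $\mathrm{Hom}_{k\mathcal{T}}(G,H)=kB(H,G)$, with composition the $k$-bilinear extension of $[V]\circ[U]=[V\times_H U]$, where $V\times_HU=(V\times U)/H$ for a $(K,H)$-biset $V$ and an $(H,G)$-biset $U$, and with identity of $G$ the class of the $(G,G)$-biset $G$. Let $\mathcal{F}_{\mathcal{T},k}$ be the category of $k$-linear functors from $k\mathcal{T}$ to $k$-modules, with natural transformations as morphisms. For $R\in\mathcal{T}$, let $kB_R=\mathrm{Hom}_{k\mathcal{T}}(R,-)\in\mathcal{F}_{\mathcal{T},k}$, so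 that $kB_R(H)=kB(H,R)$. Let $F\in\mathcal{F}_{\mathcal{T},k}$. An element of $F$ is a pair $(R,v)$ with $R\in\mathcal{T}$ and $v\in F(R)$; $F$ is finitely generated if there is a finite set $\mathcal{G}$ of elements of $F$ such that the intersection of all subfunctors $L$ of $F$ with $v\in L(R)$ for all $(R,v)\in\mathcal{G}$ is equal to $F$. For $H\in\mathcal{T}$, the residue of $F$ at $H$ is the $k$-module $$\overline{F}(H)=F(H)\Big/\sum_{\substack{T\in\mathcal{T},\ |T|<|H|\\ \alpha\in kB(H,T)}}F(\alpha)\big(F(T)\big).$$ Then the following conditions are equivalent: 1. The functor $F$ is finitely generated. 2. There exist a finite family $\mathcal{E}$ of groups in $\mathcal{T}$ (repetitions allowed) and an epimorphism $\bigoplus_{R\in\mathcal{E}}kB_R\to F$ in $\mathcal{F}_{\mathcal{T},k}$. 3. For every $H\in\mathcal{T}$, the $k$-module $\overline{F}(H)$ is finitely generated, and there exists $n\in\mathbb{N}$ such that $\overline{F}(H)=\{0\}$ for every $H\in\mathcal{T}$ with $|H|>n$. -/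

import Mathlib

open CategoryTheory MulOpposite
open scoped TensorProduct DirectSum

universe u v

/-! ### Finite `A`-sets and the Burnside group -/

/-- A finite `A`-set. The underlying set is taken to be a standard finite set `Fin n`; every finite
`A`-set is isomorphic to one of these (see `GSetClass.of`). -/
structure FinGSet (A : Type u) [Group A] : Type u where
  card : ℕ
  action : MulAction A (Fin card)

instance (A : Type u) [Group A] (X : FinGSet A) : MulAction A (Fin X.card) := X.action

/-- Two `A`-sets are isomorphic when there is an `A`-equivariant bijection between them. -/
def GSetIso (A : Type*) [Group A] (X Y : Type*) [MulAction A X] [MulAction A Y] : Prop :=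
  ∃ e : X ≃ Y, ∀ (a : A) (x : X), e (a • x) = a • e x

namespace GSetIso

variable {A : Type*} [Group A] {X Y Z X' Y' : Type*} [MulAction A X] [MulAction A Y]
  [MulAction A Z] [MulAction A X'] [MulAction A Y']

theorem refl (X : Type*) [MulAction A X] : GSetIso A X X := ⟨Equiv.refl X, fun _ _ => rfl⟩

theorem symm (h : GSetIso A X Y) : GSetIso A Y X := by
  obtain ⟨e, he⟩ := h
  exact ⟨e.symm, fun a y => by rw [Equiv.symm_apply_eq, he, Equiv.apply_symm_apply]⟩

theorem trans (h : GSetIso A X Y) (h' : GSetIso A Y Z) : GSetIso A X Z := by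
  obtain ⟨e, he⟩ := h
  obtain ⟨e', he'⟩ := h'
  exact ⟨e.trans e', fun a x => by simp [he, he']⟩

theorem sum (h : GSetIso A X X') (h' : GSetIso A Y Y') : GSetIso A (X ⊕ Y) (X' ⊕ Y') := by
  obtain ⟨e, he⟩ := h
  obtain ⟨e', he'⟩ := h'
  refine ⟨Equiv.sumCongr e e', ?_⟩
  rintro a (x | y)
  · simp [he]
  · simp [he']

end GSetIso

/-- Isomorphism of finite `A`-sets, as a setoid. -/
def FinGSet.setoid (A : Type u) [Group A] : Setoid (FinGSet A) where
  r X Y := GSetIso A (Fin X.card) (Fin Y.card)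
  iseqv := ⟨fun _ => GSetIso.refl _, fun h => h.symm, fun h h' => h.trans h'⟩

/-- The set of isomorphism classes of finite `A`-sets. -/
def GSetClass (A : Type u) [Group A] : Type u := Quotient (FinGSet.setoid A)

/-- The finite `A`-set on `Fin n` obtained by numbering the elements of a finite `A`-set `X`. -/
noncomputable def FinGSet.ofFinite (A : Type u) [Group A] (X : Type*) [Finite X] [MulAction A X] :
    FinGSet A where
  card := Nat.card X
  action := (Finite.equivFin X).symm.mulAction A

theorem FinGSet.ofFinite_iso (A : Type u) [Group A] (X : Type*) [Finite X] [MulAction A X] :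
    GSetIso A X (Fin (FinGSet.ofFinite A X).card) := by
  refine ⟨Finite.equivFin X, fun a x => ?_⟩
  change _ = (Finite.equivFin X).symm.symm (a • (Finite.equivFin X).symm (Finite.equivFin X x))
  rw [Equiv.symm_apply_apply]
  rfl

/-- The isomorphism class of an arbitrary finite `A`-set. -/
noncomputable def GSetClass.of (A : Type u) [Group A] (X : Type*) [Finite X] [MulAction A X] :
    GSetClass A :=
  Quotient.mk (FinGSet.setoid A) (FinGSet.ofFinite A X)

theorem GSetClass.of_eq_of_iff {A : Type u} [Group A] {X Y : Type*} [Finite X] [Finite Y]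
    [MulAction A X] [MulAction A Y] : GSetClass.of A X = GSetClass.of A Y ↔ GSetIso A X Y := by
  refine (Quotient.eq (r := FinGSet.setoid A)).trans ?_
  exact ⟨fun h => ((FinGSet.ofFinite_iso A X).trans h).trans (FinGSet.ofFinite_iso A Y).symm,
    fun h => ((FinGSet.ofFinite_iso A X).symm.trans h).trans (FinGSet.ofFinite_iso A Y)⟩

theorem GSetClass.exists_rep {A : Type u} [Group A] (c : GSetClass A) :
    ∃ X : FinGSet A, c = GSetClass.of A (Fin X.card) := by
  induction c using Quotient.inductionOn with
  | h X => exact ⟨X, Quotient.sound (s := FinGSet.setoid A) (FinGSet.ofFinite_iso A _)⟩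

/-- The subgroup of relations `[X ⊔ Y] - [X] - [Y]`. -/
noncomputable def burnsideRel (A : Type u) [Group A] : AddSubgroup (FreeAbelianGroup (GSetClass A)) :=
  AddSubgroup.closure {r | ∃ X Y : FinGSet A,
    r = FreeAbelianGroup.of (GSetClass.of A (Fin X.card ⊕ Fin Y.card))
      - FreeAbelianGroup.of (GSetClass.of A (Fin X.card))
      - FreeAbelianGroup.of (GSetClass.of A (Fin Y.card))}

/-- The Burnside group `B(A)`: the free abelian group on the isomorphism classes of finite `A`-sets
modulo the relations `[X ⊔ Y] = [X] + [Y]`. -/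
abbrev BurnsideGroup (A : Type u) [Group A] : Type u :=
  FreeAbelianGroup (GSetClass A) ⧸ burnsideRel A

namespace BurnsideGroup

variable {A : Type u} [Group A]

/-- The image in `B(A)` of an isomorphism class. -/
noncomputable def ofClass (c : GSetClass A) : BurnsideGroup A :=
  QuotientAddGroup.mk (FreeAbelianGroup.of c)

/-- The class `[X]` in `B(A)` of a finite `A`-set `X`. -/
noncomputable def of (A : Type u) [Group A] (X : Type*) [Finite X] [MulAction A X] :
    BurnsideGroup A :=
  ofClass (GSetClass.of A X)

theorem of_eq {X Y : Type*} [Finite X] [Finite Y] [MulAction A X] [MulAction A Y]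
    (h : GSetIso A X Y) : of A X = of A Y := by
  unfold of
  rw [GSetClass.of_eq_of_iff.2 h]

theorem of_sum (X Y : Type*) [Finite X] [Finite Y] [MulAction A X] [MulAction A Y] :
    of A (X ⊕ Y) = of A X + of A Y := by
  have hX := FinGSet.ofFinite_iso A X
  have hY := FinGSet.ofFinite_iso A Y
  rw [of_eq hX, of_eq hY, of_eq (hX.sum hY), ← sub_eq_zero, ← sub_sub]
  exact (QuotientAddGroup.eq_zero_iff _).2
    (AddSubgroup.subset_closure ⟨FinGSet.ofFinite A X, FinGSet.ofFinite A Y, rfl⟩)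

/-- The universal property of `B(A)`. -/
noncomputable def lift {M : Type*} [AddCommGroup M] (f : GSetClass A → M)
    (hf : ∀ X Y : FinGSet A, f (GSetClass.of A (Fin X.card ⊕ Fin Y.card)) =
      f (GSetClass.of A (Fin X.card)) + f (GSetClass.of A (Fin Y.card))) :
    BurnsideGroup A →+ M :=
  QuotientAddGroup.lift (burnsideRel A) (FreeAbelianGroup.lift f) (by
    unfold burnsideRel
    rw [AddSubgroup.closure_le]
    rintro _ ⟨X, Y, rfl⟩
    simp [hf])

@[simp]
theorem lift_ofClass {M : Type*} [AddCommGroup M] (f : GSetClass A → M) (hf) (c : GSetClass A) :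
    lift f hf (ofClass c) = f c := by
  simp only [lift, ofClass, QuotientAddGroup.lift_mk, FreeAbelianGroup.lift_apply_of]

theorem hom_ext {M : Type*} [AddCommGroup M] {f g : BurnsideGroup A →+ M}
    (h : ∀ X : FinGSet A, f (of A (Fin X.card)) = g (of A (Fin X.card))) : f = g := by
  apply QuotientAddGroup.addMonoidHom_ext
  ext c
  obtain ⟨X, rfl⟩ := c.exists_rep
  exact h X

theorem induction {p : BurnsideGroup A → Prop}
    (of : ∀ X : FinGSet A, p (of A (Fin X.card))) (add : ∀ x y, p x → p y → p (x + y))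
    (neg : ∀ x, p x → p (-x)) (x : BurnsideGroup A) : p x := by
  obtain ⟨x, rfl⟩ := QuotientAddGroup.mk_surjective x
  have key : ∀ c : GSetClass A, p (ofClass c) := fun c => by
    obtain ⟨X, rfl⟩ := c.exists_rep
    exact of X
  induction x using FreeAbelianGroup.induction_on with
  | zero =>
    have h := of ⟨1, { smul := fun _ x => x, one_smul := fun _ => rfl, mul_smul := fun _ _ _ => rfl }⟩
    simpa using add _ _ h (neg _ h)
  | of c => exact key c
  | neg c _ => exact neg _ (key c)
  | add x y hx hy => exact add _ _ hx hy

end BurnsideGroup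

/-! ### Bisets and their composition

An `(H, G)`-biset is a set with an action of `H × Gᵐᵒᵖ`: the element `h` acts on the left as
`(h, 1)`, and `g` acts on the right as `(1, op g)`. -/

section Tensor

variable (K H G : Type*) [Group K] [Group H] [Group G] (V U : Type*)
  [MulAction (K × Hᵐᵒᵖ) V] [MulAction (H × Gᵐᵒᵖ) U]

/-- The relation on `V × U` of being in the same orbit of `H`, for the right action
`(v, u) h = (v h, h⁻¹ u)`. -/
def bisetSetoid : Setoid (V × U) where
  r p q := ∃ h : H, q = (((1, op h) : K × Hᵐᵒᵖ) • p.1, ((h⁻¹, 1) : H × Gᵐᵒᵖ) • p.2)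
  iseqv := by
    refine ⟨fun p => ⟨1, ?_⟩, ?_, ?_⟩
    · rw [op_one, inv_one, Prod.mk_one_one, Prod.mk_one_one, one_smul, one_smul]
    · rintro p _ ⟨h, rfl⟩
      exact ⟨h⁻¹, by simp [smul_smul, ← Prod.one_eq_mk]⟩
    · rintro p _ _ ⟨h, rfl⟩ ⟨h', rfl⟩
      exact ⟨h * h', by simp [smul_smul]⟩

/-- The composition `V ×_H U = (V × U) / H` of a `(K, H)`-biset `V` and an `(H, G)`-biset `U`. -/
def BisetTensor : Type _ := Quotient (bisetSetoid K H G V U)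

namespace BisetTensor

variable {V U}

/-- The class of `(v, u)` in `V ×_H U`. -/
def mk (v : V) (u : U) : BisetTensor K H G V U := Quotient.mk (bisetSetoid K H G V U) (v, u)

theorem mk_eq_mk_iff {v v' : V} {u u' : U} : mk K H G v u = mk K H G v' u' ↔
    ∃ h : H, v' = ((1, op h) : K × Hᵐᵒᵖ) • v ∧ u' = ((h⁻¹, 1) : H × Gᵐᵒᵖ) • u := by
  refine (Quotient.eq (r := bisetSetoid K H G V U)).trans ?_
  exact exists_congr fun h => Prod.mk_inj

theorem mk_balanced (v : V) (h : H) (u : U) :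
    mk K H G (((1, op h) : K × Hᵐᵒᵖ) • v) u = mk K H G v (((h, 1) : H × Gᵐᵒᵖ) • u) :=
  (mk_eq_mk_iff K H G).2 ⟨h⁻¹, by simp [smul_smul, ← Prod.one_eq_mk], by simp⟩

variable {K H G} in
/-- A balanced map out of `V × U` factors through `V ×_H U`. -/
def lift {X : Type*} (f : V → U → X) (hf : ∀ (v : V) (h : H) (u : U),
    f (((1, op h) : K × Hᵐᵒᵖ) • v) u = f v (((h, 1) : H × Gᵐᵒᵖ) • u)) :
    BisetTensor K H G V U → X :=
  Quotient.lift (fun p => f p.1 p.2) (by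
    rintro p _ ⟨h, rfl⟩
    simp [hf, smul_smul, ← Prod.one_eq_mk])

variable {K H G} in
theorem ind {p : BisetTensor K H G V U → Prop} (h : ∀ v u, p (mk K H G v u)) (x) : p x :=
  Quotient.inductionOn x fun ⟨v, u⟩ => h v u

instance [Finite V] [Finite U] : Finite (BisetTensor K H G V U) :=
  inferInstanceAs (Finite (Quotient _))

/-- The `(K, G)`-biset structure on `V ×_H U`: `k [v, u] g = [k v, u g]`. -/
instance : MulAction (K × Gᵐᵒᵖ) (BisetTensor K H G V U) where
  smul a := Quotient.map (fun p => (((a.1, 1) : K × Hᵐᵒᵖ) • p.1, ((1, a.2) : H × Gᵐᵒᵖ) • p.2)) (by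
    rintro p _ ⟨h, rfl⟩
    exact ⟨h, by simp [smul_smul]⟩)
  one_smul := ind fun v u => by
    change mk K H G _ _ = _
    simp [← Prod.one_eq_mk]
  mul_smul a b := ind fun v u => by
    change mk K H G _ _ = mk K H G _ _
    simp [smul_smul]

theorem smul_mk (a : K × Gᵐᵒᵖ) (v : V) (u : U) :
    a • mk K H G v u = mk K H G (((a.1, 1) : K × Hᵐᵒᵖ) • v) (((1, a.2) : H × Gᵐᵒᵖ) • u) := rfl

end BisetTensor

/-- The identity `(G, G)`-biset: the set `G` with left and right multiplication. -/
@[ext]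
structure IdBiset (G : Type*) where
  val : G

instance (G : Type*) [Finite G] : Finite (IdBiset G) :=
  Finite.of_injective IdBiset.val fun _ _ => IdBiset.ext

instance (G : Type*) [Group G] : MulAction (G × Gᵐᵒᵖ) (IdBiset G) where
  smul a x := ⟨a.1 * x.val * a.2.unop⟩
  one_smul x := IdBiset.ext (show 1 * x.val * 1 = x.val by simp)
  mul_smul a b x := IdBiset.ext (show a.1 * b.1 * x.val * (b.2.unop * a.2.unop) =
    a.1 * (b.1 * x.val * b.2.unop) * a.2.unop by simp [mul_assoc])

@[simp]
theorem IdBiset.smul_val {G : Type*} [Group G] (a : G × Gᵐᵒᵖ) (x : IdBiset G) :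
    (a • x).val = a.1 * x.val * a.2.unop := rfl

end Tensor

section TensorIso

variable {L K H G : Type*} [Group L] [Group K] [Group H] [Group G] {V V' U U' W : Type*}
  [MulAction (K × Hᵐᵒᵖ) V] [MulAction (K × Hᵐᵒᵖ) V'] [MulAction (H × Gᵐᵒᵖ) U]
  [MulAction (H × Gᵐᵒᵖ) U'] [MulAction (L × Kᵐᵒᵖ) W]

theorem BisetTensor.iso_congr (hV : GSetIso (K × Hᵐᵒᵖ) V V') (hU : GSetIso (H × Gᵐᵒᵖ) U U') :
    GSetIso (K × Gᵐᵒᵖ) (BisetTensor K H G V U) (BisetTensor K H G V' U') := by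
  obtain ⟨e, he⟩ := hV
  obtain ⟨f, hf⟩ := hU
  refine ⟨Quotient.congr (Equiv.prodCongr e f) ?_, fun a => ?_⟩
  · rintro ⟨v, u⟩ ⟨v', u'⟩
    change (∃ h : H, _) ↔ (∃ h : H, _)
    refine exists_congr fun h => ?_
    simp [Prod.ext_iff, ← he, ← hf]
  · refine BisetTensor.ind fun v u => ?_
    change mk K H G (e _) (f _) = mk K H G (_ • e v) (_ • f u)
    rw [he, hf]

theorem BisetTensor.iso_sum_left : GSetIso (K × Gᵐᵒᵖ) (BisetTensor K H G (V ⊕ V') U)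
    (BisetTensor K H G V U ⊕ BisetTensor K H G V' U) := by
  refine ⟨⟨lift (fun x u => Sum.map (fun v => mk K H G v u) (fun v => mk K H G v u) x) ?_,
    Sum.elim (lift (fun v u => mk K H G (Sum.inl v) u) ?_)
      (lift (fun v u => mk K H G (Sum.inr v) u) ?_), ?_, ?_⟩, ?_⟩
  · rintro (v | v) h u
    · exact congrArg Sum.inl (mk_balanced K H G v h u)
    · exact congrArg Sum.inr (mk_balanced K H G v h u)
  · exact fun v h u => mk_balanced K H G (Sum.inl v : V ⊕ V') h u
  · exact fun v h u => mk_balanced K H G (Sum.inr v : V ⊕ V') h u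
  · refine BisetTensor.ind ?_
    rintro (v | v) u <;> rfl
  · rintro (x | x) <;> revert x <;> exact BisetTensor.ind fun v u => rfl
  · intro a
    refine BisetTensor.ind ?_
    rintro (v | v) u <;> rfl

theorem BisetTensor.iso_sum_right : GSetIso (K × Gᵐᵒᵖ) (BisetTensor K H G V (U ⊕ U'))
    (BisetTensor K H G V U ⊕ BisetTensor K H G V U') := by
  refine ⟨⟨lift (fun v x => Sum.map (fun u => mk K H G v u) (fun u => mk K H G v u) x) ?_,
    Sum.elim (lift (fun v u => mk K H G v (Sum.inl u)) ?_)
      (lift (fun v u => mk K H G v (Sum.inr u)) ?_), ?_, ?_⟩, ?_⟩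
  · rintro v h (u | u)
    · exact congrArg Sum.inl (mk_balanced K H G v h u)
    · exact congrArg Sum.inr (mk_balanced K H G v h u)
  · exact fun v h u => mk_balanced K H G v h (Sum.inl u : U ⊕ U')
  · exact fun v h u => mk_balanced K H G v h (Sum.inr u : U ⊕ U')
  · refine BisetTensor.ind ?_
    rintro v (u | u) <;> rfl
  · rintro (x | x) <;> revert x <;> exact BisetTensor.ind fun v u => rfl
  · intro a
    refine BisetTensor.ind ?_
    rintro v (u | u) <;> rfl

theorem BisetTensor.iso_assoc : GSetIso (L × Gᵐᵒᵖ)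
    (BisetTensor L H G (BisetTensor L K H W V) U)
    (BisetTensor L K G W (BisetTensor K H G V U)) := by
  refine ⟨⟨lift (fun x u => lift (fun w v => mk L K G w (mk K H G v u)) ?_ x) ?_,
    lift (fun w x => lift (fun v u => mk L H G (mk L K H w v) u) ?_ x) ?_, ?_, ?_⟩, ?_⟩
  · intro w k v
    refine (mk_balanced L K G w k (mk K H G v u)).trans ?_
    rw [smul_mk, Prod.mk_one_one, one_smul]
  · intro x h u
    revert x
    refine BisetTensor.ind fun w v => ?_
    change mk L K G (((1, 1) : L × Kᵐᵒᵖ) • w) (mk K H G (((1, op h) : K × Hᵐᵒᵖ) • v) u) =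
      mk L K G w (mk K H G v (((h, 1) : H × Gᵐᵒᵖ) • u))
    rw [Prod.mk_one_one, one_smul, mk_balanced]
  · intro v h u
    refine Eq.trans ?_ (mk_balanced L H G (mk L K H w v) h u)
    rw [smul_mk, Prod.mk_one_one, one_smul]
  · intro w k x
    revert x
    refine BisetTensor.ind fun v u => ?_
    change mk L H G (mk L K H (((1, op k) : L × Kᵐᵒᵖ) • w) v) u =
      mk L H G (mk L K H w (((k, 1) : K × Hᵐᵒᵖ) • v)) (((1, 1) : H × Gᵐᵒᵖ) • u)
    rw [Prod.mk_one_one, one_smul, mk_balanced]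
  · refine BisetTensor.ind fun x u => ?_
    revert x
    exact BisetTensor.ind fun w v => rfl
  · refine BisetTensor.ind fun w x => ?_
    revert x
    exact BisetTensor.ind fun v u => rfl
  · intro a
    refine BisetTensor.ind fun x u => ?_
    revert x
    refine BisetTensor.ind fun w v => ?_
    change mk L K G (((a.1, 1) : L × Kᵐᵒᵖ) • w)
        (mk K H G (((1, 1) : K × Hᵐᵒᵖ) • v) (((1, a.2) : H × Gᵐᵒᵖ) • u)) =
      mk L K G (((a.1, 1) : L × Kᵐᵒᵖ) • w)
        (mk K H G (((1, 1) : K × Hᵐᵒᵖ) • v) (((1, a.2) : H × Gᵐᵒᵖ) • u))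
    rfl

theorem BisetTensor.iso_id_left : GSetIso (H × Gᵐᵒᵖ) (BisetTensor H H G (IdBiset H) U) U := by
  refine ⟨⟨lift (fun h u => ((h.val, 1) : H × Gᵐᵒᵖ) • u) ?_, fun u => mk H H G ⟨1⟩ u, ?_, ?_⟩, ?_⟩
  · intro x h u
    simp [smul_smul]
  · refine BisetTensor.ind fun x u => ?_
    refine (mk_balanced H H G (⟨1⟩ : IdBiset H) x.val u).symm.trans ?_
    congr 1
    ext
    simp
  · intro u
    change ((1, 1) : H × Gᵐᵒᵖ) • u = u
    rw [Prod.mk_one_one, one_smul]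
  · intro a
    refine BisetTensor.ind fun x u => ?_
    change (((((a.1, 1) : H × Hᵐᵒᵖ) • x).val, 1) : H × Gᵐᵒᵖ) • ((1, a.2) : H × Gᵐᵒᵖ) • u =
      a • ((x.val, 1) : H × Gᵐᵒᵖ) • u
    rw [smul_smul, smul_smul]
    congr 1
    ext <;> simp

theorem BisetTensor.iso_id_right : GSetIso (K × Hᵐᵒᵖ) (BisetTensor K H H V (IdBiset H)) V := by
  refine ⟨⟨lift (fun v h => ((1, op h.val) : K × Hᵐᵒᵖ) • v) ?_, fun v => mk K H H v ⟨1⟩, ?_, ?_⟩,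
    ?_⟩
  · intro v h x
    simp [smul_smul]
  · refine BisetTensor.ind fun v x => ?_
    refine (mk_balanced K H H v x.val (⟨1⟩ : IdBiset H)).trans ?_
    congr 1
    ext
    simp
  · intro v
    change ((1, op 1) : K × Hᵐᵒᵖ) • v = v
    rw [op_one, Prod.mk_one_one, one_smul]
  · intro a
    refine BisetTensor.ind fun v x => ?_
    change ((1, op (((1, a.2) : H × Hᵐᵒᵖ) • x).val) : K × Hᵐᵒᵖ) • ((a.1, 1) : K × Hᵐᵒᵖ) • v =
      a • ((1, op x.val) : K × Hᵐᵒᵖ) • v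
    rw [smul_smul, smul_smul]
    congr 1
    ext <;> simp

end TensorIso

/-! ### The biset category -/

/-- `B(H, G) = B(H × Gᵒᵖ)`, the Burnside group of finite `(H, G)`-bisets. -/
abbrev BisetBurnside (H G : Type u) [Group H] [Group G] : Type u := BurnsideGroup (H × Gᵐᵒᵖ)

section Composition

variable (L K H G : Type u) [Group L] [Group K] [Group H] [Group G]

/-- The class of `V ×_H U`, as a function of the classes of `V` and `U`. -/
noncomputable def bisetCompClass (c : GSetClass (K × Hᵐᵒᵖ)) (d : GSetClass (H × Gᵐᵒᵖ)) :
    GSetClass (K × Gᵐᵒᵖ) :=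
  Quotient.liftOn₂ c d
    (fun V U => GSetClass.of (K × Gᵐᵒᵖ) (BisetTensor K H G (Fin V.card) (Fin U.card)))
    fun _ _ _ _ h h' => GSetClass.of_eq_of_iff.2 (BisetTensor.iso_congr h h')

theorem bisetCompClass_of (V U : Type*) [Finite V] [Finite U] [MulAction (K × Hᵐᵒᵖ) V]
    [MulAction (H × Gᵐᵒᵖ) U] :
    bisetCompClass K H G (GSetClass.of _ V) (GSetClass.of _ U) =
      GSetClass.of _ (BisetTensor K H G V U) :=
  GSetClass.of_eq_of_iff.2
    (BisetTensor.iso_congr (FinGSet.ofFinite_iso _ V).symm (FinGSet.ofFinite_iso _ U).symm)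

/-- The composition `B(K, H) × B(H, G) → B(K, G)`, the biadditive map sending `([V], [U])` to
`[V ×_H U]`. -/
noncomputable def bisetComp : BisetBurnside K H →+ BisetBurnside H G →+ BisetBurnside K G :=
  BurnsideGroup.lift
    (fun c => BurnsideGroup.lift (fun d => BurnsideGroup.ofClass (bisetCompClass K H G c d)) (by
      intro X Y
      obtain ⟨V, rfl⟩ := c.exists_rep
      simp only [bisetCompClass_of]
      exact (BurnsideGroup.of_eq BisetTensor.iso_sum_right).trans (BurnsideGroup.of_sum _ _)))
    (by
      intro X Y
      refine BurnsideGroup.hom_ext fun U => ?_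
      simp only [AddMonoidHom.add_apply, BurnsideGroup.of, BurnsideGroup.lift_ofClass,
        bisetCompClass_of]
      exact (BurnsideGroup.of_eq BisetTensor.iso_sum_left).trans (BurnsideGroup.of_sum _ _))

theorem bisetComp_of (V U : Type*) [Finite V] [Finite U] [MulAction (K × Hᵐᵒᵖ) V]
    [MulAction (H × Gᵐᵒᵖ) U] :
    bisetComp K H G (BurnsideGroup.of _ V) (BurnsideGroup.of _ U) =
      BurnsideGroup.of _ (BisetTensor K H G V U) := by
  simp only [bisetComp, BurnsideGroup.of, BurnsideGroup.lift_ofClass, bisetCompClass_of]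

/-- The identity of `G` in the biset category. -/
noncomputable def bisetId [Finite G] : BisetBurnside G G := BurnsideGroup.of _ (IdBiset G)

variable {L K H G}

theorem bisetComp_id_left [Finite H] (b : BisetBurnside H G) :
    bisetComp H H G (bisetId H) b = b := by
  refine DFunLike.congr_fun (f := bisetComp H H G (bisetId H)) (g := AddMonoidHom.id _)
    (BurnsideGroup.hom_ext fun U => ?_) b
  exact (bisetComp_of _ _ _ _ _).trans (BurnsideGroup.of_eq BisetTensor.iso_id_left)

theorem bisetComp_id_right [Finite H] (a : BisetBurnside K H) :
    bisetComp K H H a (bisetId H) = a := by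
  refine DFunLike.congr_fun (f := (bisetComp K H H).flip (bisetId H)) (g := AddMonoidHom.id _)
    (BurnsideGroup.hom_ext fun U => ?_) a
  exact (bisetComp_of _ _ _ _ _).trans (BurnsideGroup.of_eq BisetTensor.iso_id_right)

theorem bisetComp_assoc (a : BisetBurnside L K) (b : BisetBurnside K H) (c : BisetBurnside H G) :
    bisetComp L H G (bisetComp L K H a b) c = bisetComp L K G a (bisetComp K H G b c) := by
  induction a using BurnsideGroup.induction with
  | add x y hx hy => simp only [map_add, AddMonoidHom.add_apply, hx, hy]
  | neg x hx => simp only [map_neg, AddMonoidHom.neg_apply, hx]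
  | of W =>
  induction b using BurnsideGroup.induction with
  | add x y hx hy => simp only [map_add, AddMonoidHom.add_apply, hx, hy]
  | neg x hx => simp only [map_neg, AddMonoidHom.neg_apply, hx]
  | of V =>
  induction c using BurnsideGroup.induction with
  | add x y hx hy => simp only [map_add, hx, hy]
  | neg x hx => simp only [map_neg, hx]
  | of U =>
  simp only [bisetComp_of]
  exact BurnsideGroup.of_eq BisetTensor.iso_assoc

end Composition

/-- `kB(H, G) = k ⊗ B(H, G)`. -/
abbrev LinBisetBurnside (k : Type v) [CommRing k] (H G : Type u) [Group H] [Group G] :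
    Type (max u v) :=
  k ⊗[ℤ] BisetBurnside H G

section LinComposition

variable (k : Type v) [CommRing k] (L K H G : Type u) [Group L] [Group K] [Group H] [Group G]

/-- The `k`-bilinear extension of the composition of bisets. -/
noncomputable def linBisetComp : LinBisetBurnside k K H →ₗ[k] LinBisetBurnside k H G →ₗ[k]
    LinBisetBurnside k K G :=
  LinearMap.liftBaseChange k (AddMonoidHom.toIntLinearMap
    { toFun := fun a => (bisetComp K H G a).toIntLinearMap.baseChange k
      map_zero' := by ext; simp
      map_add' := fun a b => by ext; simp [TensorProduct.tmul_add] })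

@[simp]
theorem linBisetComp_tmul (r s : k) (a : BisetBurnside K H) (b : BisetBurnside H G) :
    linBisetComp k K H G (r ⊗ₜ a) (s ⊗ₜ b) = (r * s) ⊗ₜ bisetComp K H G a b := by
  simp [linBisetComp, TensorProduct.smul_tmul']

variable {k L K H G}

theorem linBisetComp_id_left [Finite H] (b : LinBisetBurnside k H G) :
    linBisetComp k H H G (1 ⊗ₜ bisetId H) b = b := by
  induction b using TensorProduct.induction_on with
  | zero => simp
  | tmul r b => simp [bisetComp_id_left]
  | add x y hx hy => rw [map_add, hx, hy]

theorem linBisetComp_id_right [Finite H] (a : LinBisetBurnside k K H) :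
    linBisetComp k K H H a (1 ⊗ₜ bisetId H) = a := by
  induction a using TensorProduct.induction_on with
  | zero => simp
  | tmul r b => simp [bisetComp_id_right]
  | add x y hx hy => rw [map_add, LinearMap.add_apply, hx, hy]

theorem linBisetComp_assoc (a : LinBisetBurnside k L K) (b : LinBisetBurnside k K H)
    (c : LinBisetBurnside k H G) :
    linBisetComp k L H G (linBisetComp k L K H a b) c =
      linBisetComp k L K G a (linBisetComp k K H G b c) := by
  induction a using TensorProduct.induction_on with
  | zero => simp
  | add x y hx hy => simp only [map_add, LinearMap.add_apply, hx, hy]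
  | tmul r a =>
  induction b using TensorProduct.induction_on with
  | zero => simp
  | add x y hx hy => simp only [map_add, LinearMap.add_apply, hx, hy]
  | tmul s b =>
  induction c using TensorProduct.induction_on with
  | zero => simp
  | add x y hx hy => simp only [map_add, hx, hy]
  | tmul t c => simp only [linBisetComp_tmul, bisetComp_assoc, mul_assoc]

end LinComposition

/-- The objects of the `k`-linear biset category `k𝒞`: all finite groups. -/
structure BisetCat (k : Type v) [CommRing k] : Type (u + 1) where
  grp : FiniteGrp.{u}

/-- The category `k𝒞`: a morphism from `G` to `H` is an element of `kB(H, G)`, and the composition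
of `α : G ⟶ H` and `β : H ⟶ K` is `β ×_H α`. -/
noncomputable instance (k : Type v) [CommRing k] : Category.{max u v} (BisetCat.{u} k) where
  Hom G H := LinBisetBurnside k H.grp G.grp
  id G := 1 ⊗ₜ bisetId G.grp
  comp {G H K} α β := linBisetComp k K.grp H.grp G.grp β α
  id_comp α := linBisetComp_id_right α
  comp_id α := linBisetComp_id_left α
  assoc α β γ := (linBisetComp_assoc γ β α).symm

noncomputable instance (k : Type v) [CommRing k] : Preadditive (BisetCat.{u} k) where
  homGroup G H := inferInstanceAs (AddCommGroup (LinBisetBurnside k H.grp G.grp))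
  add_comp _ _ _ f f' g := (linBisetComp _ _ _ _ g).map_add f f'
  comp_add _ _ _ f g g' := DFunLike.congr_fun ((linBisetComp _ _ _ _).map_add g g') f

noncomputable instance (k : Type v) [CommRing k] : Linear k (BisetCat.{u} k) where
  homModule G H := inferInstanceAs (Module k (LinBisetBurnside k H.grp G.grp))
  smul_comp _ _ _ r f g := (linBisetComp _ _ _ _ g).map_smul r f
  comp_smul _ _ _ f r g := DFunLike.congr_fun ((linBisetComp _ _ _ _).map_smul r g) f

/-! ### Biset functors on a class of finite groups -/

/-- `H` is a subquotient of `G` if it is isomorphic to `B / A` for some subgroups `A ⊴ B ≤ G`. -/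
def IsSubquotient (H G : Type*) [Group H] [Group G] : Prop :=
  ∃ (B : Subgroup G) (A : Subgroup B) (_ : A.Normal), Nonempty (B ⧸ A ≃* H)

/-- The class `𝒯` of finite groups is closed under taking subquotients. -/
def ClosedUnderSubquotients (𝒯 : FiniteGrp.{u} → Prop) : Prop :=
  ∀ G H : FiniteGrp.{u}, 𝒯 G → IsSubquotient H G → 𝒯 H

/-- The full subcategory `k𝒯` of `k𝒞` on the groups in `𝒯`. -/
abbrev BisetCatOn (k : Type v) [CommRing k] (𝒯 : FiniteGrp.{u} → Prop) : Type (u + 1) :=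
  ObjectProperty.FullSubcategory fun G : BisetCat.{u} k => 𝒯 G.grp

/-- The finite group underlying an object of `k𝒯`. -/
abbrev BisetCatOn.group {k : Type v} [CommRing k] {𝒯 : FiniteGrp.{u} → Prop}
    (G : BisetCatOn k 𝒯) : FiniteGrp.{u} := G.obj.grp

/-- The category `ℱ_{𝒯,k}` of `k`-linear functors from `k𝒯` to `k`-modules, a full subcategory of
the category of all functors. -/
abbrev BisetFunctor (k : Type v) [CommRing k] (𝒯 : FiniteGrp.{u} → Prop) :
    Type (max (u + 1) (v + 1)) :=
  ObjectProperty.FullSubcategory fun F : BisetCatOn k 𝒯 ⥤ ModuleCat.{max u v} k =>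
    F.Additive ∧ F.Linear k

namespace BisetFunctor

variable {k : Type v} [CommRing k] {𝒯 : FiniteGrp.{u} → Prop}

/-- A subfunctor of `F`: a family of submodules `L(H) ≤ F(H)` stable under all `F(α)`. -/
structure Subfunctor (F : BisetFunctor k 𝒯) where
  carrier : ∀ H : BisetCatOn k 𝒯, Submodule k (F.obj.obj H)
  map_mem : ∀ {G H : BisetCatOn k 𝒯} (α : G ⟶ H) (x : F.obj.obj G), x ∈ carrier G →
    F.obj.map α x ∈ carrier H

/-- An element of `F` is a pair `(R, v)` with `R ∈ 𝒯` and `v ∈ F(R)`. -/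
abbrev Element (F : BisetFunctor k 𝒯) : Type _ := Σ R : BisetCatOn k 𝒯, F.obj.obj R

/-- The subfunctor `⟨𝒢⟩` generated by a set of elements of `F`: the intersection of all the
subfunctors containing `𝒢`. -/
def generated (F : BisetFunctor k 𝒯) (𝒢 : Set F.Element) : F.Subfunctor where
  carrier H := ⨅ L ∈ {L : F.Subfunctor | ∀ g ∈ 𝒢, g.2 ∈ L.carrier g.1}, L.carrier H
  map_mem α x hx := by
    simp only [Submodule.mem_iInf] at hx ⊢
    exact fun L hL => L.map_mem α x (hx L hL)

/-- `F` is finitely generated if `⟨𝒢⟩ = F` for some finite set `𝒢` of elements of `F`. -/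
def IsFinitelyGenerated (F : BisetFunctor k 𝒯) : Prop :=
  ∃ 𝒢 : Set F.Element, 𝒢.Finite ∧ ∀ H, (F.generated 𝒢).carrier H = ⊤

/-- The submodule of `F(H)` spanned by the images of all `F(α)`, for `α ∈ kB(H, T)` with `T ∈ 𝒯`
and `|T| < |H|`. -/
def residueKer (F : BisetFunctor k 𝒯) (H : BisetCatOn k 𝒯) : Submodule k (F.obj.obj H) :=
  ⨆ (T : BisetCatOn k 𝒯) (_ : Nat.card T.group < Nat.card H.group) (α : T ⟶ H),
    LinearMap.range (F.obj.map α).hom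

/-- The residue (Brauer quotient) of `F` at `H`. -/
abbrev Residue (F : BisetFunctor k 𝒯) (H : BisetCatOn k 𝒯) : Type (max u v) :=
  F.obj.obj H ⧸ F.residueKer H

/-- The representable functor `kB_R = Hom(R, -)`, whose value at `H` is `kB(H, R)`. -/
noncomputable def representable (R : BisetCatOn k 𝒯) : BisetFunctor k 𝒯 where
  obj := (linearCoyoneda k (BisetCatOn k 𝒯)).obj (Opposite.op R)
  property := ⟨inferInstance, ⟨fun f r => by
    ext g
    exact Linear.comp_smul _ _ _ g r f⟩⟩

/-- The direct sum of a family of biset functors, computed pointwise. -/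
noncomputable def directSum {ι : Type} (P : ι → BisetFunctor k 𝒯) : BisetFunctor k 𝒯 where
  obj :=
    { obj := fun H => ModuleCat.of k (⨁ i, (P i).obj.obj H)
      map := fun α => ModuleCat.ofHom (DirectSum.lmap fun i => ((P i).obj.map α).hom)
      map_id := fun H => ModuleCat.hom_ext (LinearMap.ext fun x => DFinsupp.ext fun i =>
        congrArg (fun φ => φ.hom (x i)) ((P i).obj.map_id H))
      map_comp := fun α β => ModuleCat.hom_ext (LinearMap.ext fun x => DFinsupp.ext fun i =>
        congrArg (fun φ => φ.hom (x i)) ((P i).obj.map_comp α β)) }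
  property :=
    ⟨⟨fun {_ _ α β} => ModuleCat.hom_ext (LinearMap.ext fun x => DFinsupp.ext fun i =>
        congrArg (fun φ => φ.hom (x i)) ((P i).property.1.map_add (f := α) (g := β)))⟩,
      ⟨fun α r => ModuleCat.hom_ext (LinearMap.ext fun x => DFinsupp.ext fun i =>
        congrArg (fun φ => φ.hom (x i)) ((P i).property.2.map_smul α r))⟩⟩

end BisetFunctor

/-!
Call the elements of `F(H)` coming from groups smaller than `H` decomposable, so that the residue
is the quotient of `F(H)` by them. A form of Nakayama's lemma holds: if every `F(H)` is spanned by
`L(H)` and the decomposable elements, for a subfunctor `L`, then `L = F`, by induction on `|H|`.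
Since there are finitely many isomorphism classes of groups of order at most `n`, lifting generators
of the residues at representatives of these classes gives a finite generating set of `F`.

Conversely, the Yoneda lemma turns finitely many generators into an epimorphism from a sum of
functors `kB_R`, and residues preserve epimorphisms. Every `α ∈ kB(H, R)` is the image of the
identity of `R` under `kB_R(α)`, so the residue of `kB_R` vanishes at all groups larger than `R`,
and `kB(H, R)` is finitely generated because `B(A)` is generated by the classes of the transitive
`A`-sets `A / S`.
-/

/-! ### Finite generation of quotients and of the Burnside group -/

theorem exists_finite_span_sup_eq_top {k M : Type*} [Ring k] [AddCommGroup M] [Module k M]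
    (N : Submodule k M) [Module.Finite k (M ⧸ N)] :
    ∃ s : Set M, s.Finite ∧ Submodule.span k s ⊔ N = ⊤ := by
  obtain ⟨t, ht⟩ := Module.Finite.fg_top (R := k) (M := M ⧸ N)
  obtain ⟨s, -, hs⟩ := (N.mkQ_surjective.surjOn (t := (t : Set (M ⧸ N)))).exists_bijOn_subset
  refine ⟨s, hs.finite_iff_finite.2 t.finite_toSet, ?_⟩
  rw [sup_comm, ← Submodule.comap_map_mkQ, Submodule.map_span, hs.image_eq, ht,
    Submodule.comap_top]

namespace GSetIso

variable {A X : Type*} [Group A] [MulAction A X]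

theorem sum_compl (Y : SubMulAction A X) : GSetIso A (Y ⊕ (Yᶜ : SubMulAction A X)) X := by
  classical
  refine ⟨Equiv.Set.sumCompl (Y : Set X), ?_⟩
  rintro a (y | y) <;> rfl

theorem orbit_quotient_stabilizer (x : X) :
    GSetIso A (MulAction.orbit A x) (A ⧸ MulAction.stabilizer A x) :=
  GSetIso.symm ⟨(MulAction.orbitEquivQuotientStabilizer A x).symm, fun a q =>
    Subtype.ext (MulAction.ofQuotientStabilizer_smul A x a q)⟩

end GSetIso

namespace BurnsideGroup

variable {A : Type u} [Group A]

theorem of_eq_zero_of_isEmpty (X : Type*) [Finite X] [MulAction A X] [IsEmpty X] :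
    of A X = 0 := by
  have h : of A (X ⊕ X) = of A X :=
    of_eq ⟨Equiv.equivOfIsEmpty _ _, fun _ x => isEmptyElim x⟩
  rwa [of_sum, add_eq_left] at h

theorem of_mem_closure_quotient [Finite A] (X : Type*) [Finite X] [MulAction A X] :
    of A X ∈ AddSubgroup.closure (Set.range fun S : Subgroup A => of A (A ⧸ S)) := by
  induction hn : Nat.card X using Nat.strong_induction_on generalizing X with
  | _ n ih =>
  subst hn
  rcases isEmpty_or_nonempty X with _ | ⟨⟨x⟩⟩
  · rw [of_eq_zero_of_isEmpty]
    exact zero_mem _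
  · let O : SubMulAction A X :=
      ⟨MulAction.orbit A x, fun a _ => MulAction.mem_orbit_of_mem_orbit a⟩
    have hO : of A O = of A (A ⧸ MulAction.stabilizer A x) :=
      of_eq (GSetIso.orbit_quotient_stabilizer x)
    have hcard : Nat.card (Oᶜ : SubMulAction A X) < Nat.card X :=
      Finite.card_subtype_lt (p := fun y => y ∈ Oᶜ) (x := x)
        fun h => h (MulAction.mem_orbit_self x)
    rw [← of_eq (GSetIso.sum_compl O), of_sum, hO]
    exact add_mem (AddSubgroup.subset_closure ⟨_, rfl⟩) (ih _ hcard _ rfl)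

theorem closure_quotient_eq_top [Finite A] :
    AddSubgroup.closure (Set.range fun S : Subgroup A => of A (A ⧸ S)) = ⊤ := by
  refine (AddSubgroup.eq_top_iff' _).2 fun x => ?_
  induction x using BurnsideGroup.induction with
  | of X => exact of_mem_closure_quotient _
  | add x y hx hy => exact add_mem hx hy
  | neg x hx => exact neg_mem hx

instance [Finite A] : Module.Finite ℤ (BurnsideGroup A) :=
  Module.Finite.iff_addGroup_fg.2
    ⟨(AddSubgroup.fg_iff _).2 ⟨_, closure_quotient_eq_top, Set.finite_range _⟩⟩

end BurnsideGroup

instance (k : Type v) [CommRing k] (H G : Type u) [Group H] [Group G] [Finite H] [Finite G] :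
    Module.Finite k (LinBisetBurnside k H G) := by
  have : Finite Gᵐᵒᵖ := Finite.of_equiv G opEquiv
  infer_instance

instance BisetCat.finite_hom {k : Type v} [CommRing k] (G H : BisetCat.{u} k) :
    Module.Finite k (G ⟶ H) :=
  inferInstanceAs (Module.Finite k (LinBisetBurnside k H.grp G.grp))

instance BisetCatOn.finite_hom {k : Type v} [CommRing k] {𝒯 : FiniteGrp.{u} → Prop}
    (G H : BisetCatOn k 𝒯) : Module.Finite k (G ⟶ H) :=
  Module.Finite.equiv (InducedCategory.homLinearEquiv (R := k) (X := G) (Y := H)).symm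

/-! ### Bisets of group homomorphisms -/

/-- For a homomorphism `φ : H →* G`, the set `G` as a `(G, H)`-biset, with `H` acting on the right
through `φ`. -/
@[ext]
structure HomBiset {H G : Type*} [Group H] [Group G] (φ : H →* G) where
  val : G

namespace HomBiset

variable {K H G : Type*} [Group K] [Group H] [Group G]

instance (φ : H →* G) [Finite G] : Finite (HomBiset φ) :=
  Finite.of_injective HomBiset.val fun _ _ => HomBiset.ext

instance (φ : H →* G) : MulAction (G × Hᵐᵒᵖ) (HomBiset φ) where
  smul a x := ⟨a.1 * x.val * φ a.2.unop⟩
  one_smul x := HomBiset.ext (show 1 * x.val * φ 1 = x.val by simp)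
  mul_smul a b x := HomBiset.ext (show a.1 * b.1 * x.val * φ (b.2.unop * a.2.unop) =
    a.1 * (b.1 * x.val * φ b.2.unop) * φ a.2.unop by simp [mul_assoc])

@[simp]
theorem smul_val (φ : H →* G) (a : G × Hᵐᵒᵖ) (x : HomBiset φ) :
    (a • x).val = a.1 * x.val * φ a.2.unop := rfl

theorem iso_id : GSetIso (G × Gᵐᵒᵖ) (HomBiset (MonoidHom.id G)) (IdBiset G) :=
  ⟨⟨fun x => ⟨x.val⟩, fun y => ⟨y.val⟩, fun _ => rfl, fun _ => rfl⟩, fun _ _ => rfl⟩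

theorem iso_comp (φ : H →* K) (ψ : G →* H) :
    GSetIso (K × Gᵐᵒᵖ) (BisetTensor K H G (HomBiset φ) (HomBiset ψ)) (HomBiset (φ.comp ψ)) := by
  refine ⟨⟨BisetTensor.lift (fun x y => ⟨x.val * φ y.val⟩) ?_,
    fun z => BisetTensor.mk K H G ⟨z.val⟩ ⟨1⟩, ?_, ?_⟩, ?_⟩
  · intro x h y
    ext
    simp [mul_assoc]
  · refine BisetTensor.ind fun x y => ?_
    have hx : (⟨x.val * φ y.val⟩ : HomBiset φ) = ((1, op y.val) : K × Hᵐᵒᵖ) • x := by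
      ext
      simp
    have hy : ((y.val, 1) : H × Gᵐᵒᵖ) • (⟨1⟩ : HomBiset ψ) = y := by
      ext
      simp
    change BisetTensor.mk K H G (⟨x.val * φ y.val⟩ : HomBiset φ) (⟨1⟩ : HomBiset ψ) = _
    rw [hx, BisetTensor.mk_balanced, hy]
  · intro z
    ext
    change z.val * φ 1 = z.val
    simp
  · intro a
    refine BisetTensor.ind fun x y => ?_
    ext
    change (((a.1, 1) : K × Hᵐᵒᵖ) • x).val * φ (((1, a.2) : H × Gᵐᵒᵖ) • y).val =
      a.1 * (x.val * φ y.val) * φ (ψ a.2.unop)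
    simp [mul_assoc]

end HomBiset

namespace BisetCat

variable {k : Type v} [CommRing k] {G H K : BisetCat.{u} k}

/-- The morphism of `k𝒞` given by the biset of a group homomorphism. -/
noncomputable def ofHom (φ : G.grp →* H.grp) : G ⟶ H :=
  (1 ⊗ₜ BurnsideGroup.of _ (HomBiset φ) : LinBisetBurnside k H.grp G.grp)

theorem ofHom_id : ofHom (MonoidHom.id G.grp) = 𝟙 G :=
  congrArg (fun x => 1 ⊗ₜ[ℤ] x) (BurnsideGroup.of_eq HomBiset.iso_id)

theorem ofHom_comp (φ : G.grp →* H.grp) (ψ : H.grp →* K.grp) :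
    ofHom (ψ.comp φ) = ofHom φ ≫ ofHom ψ := by
  change _ = linBisetComp k K.grp H.grp G.grp (1 ⊗ₜ _) (1 ⊗ₜ _)
  rw [linBisetComp_tmul, bisetComp_of, mul_one, BurnsideGroup.of_eq (HomBiset.iso_comp ψ φ), ofHom]

/-- Isomorphic groups are isomorphic objects of `k𝒞`. -/
noncomputable def isoOfMulEquiv (e : G.grp ≃* H.grp) : G ≅ H where
  hom := ofHom e.toMonoidHom
  inv := ofHom e.symm.toMonoidHom
  hom_inv_id := by
    rw [← ofHom_comp, MulEquiv.toMonoidHom_eq_coe, MulEquiv.toMonoidHom_eq_coe,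
      MulEquiv.coe_monoidHom_symm_comp_coe_monoidHom, ofHom_id]
  inv_hom_id := by
    rw [← ofHom_comp, MulEquiv.toMonoidHom_eq_coe, MulEquiv.toMonoidHom_eq_coe,
      MulEquiv.coe_monoidHom_comp_coe_monoidHom_symm, ofHom_id]

end BisetCat

/-! ### Groups of bounded order -/

section BoundedOrder

variable {ι : Type*} (G : ι → Type*) [∀ i, Group (G i)] [∀ i, Finite (G i)]

theorem exists_finite_representatives_of_card_eq (m : ℕ) :
    ∃ S : Set ι, S.Finite ∧ ∀ i, Nat.card (G i) = m → ∃ j ∈ S, Nonempty (G j ≃* G i) := by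
  let T := {i // Nat.card (G i) = m}
  let e (i : T) : G i ≃ Fin m := Finite.equivFinOfCardEq i.2
  let mulTable (i : T) (a b : Fin m) : Fin m := e i ((e i).symm a * (e i).symm b)
  have mulEquiv_of_mulTable_eq {i j : T} (h : mulTable j = mulTable i) :
      Nonempty (G j ≃* G i) :=
    ⟨⟨(e j).trans (e i).symm, fun a b => (Equiv.symm_apply_eq _).2 <| by
      simpa [mulTable] using congrFun₂ h (e j a) (e j b)⟩⟩
  obtain ⟨S, -, hS⟩ := (Set.surjOn_image mulTable Set.univ).exists_bijOn_subset
  refine ⟨Subtype.val '' S, ((hS.finite_iff_finite).2 (Set.toFinite _)).image _, fun i hi => ?_⟩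
  obtain ⟨j, hj, hji⟩ := hS.surjOn ⟨⟨i, hi⟩, trivial, rfl⟩
  exact ⟨j, ⟨j, hj, rfl⟩, mulEquiv_of_mulTable_eq hji⟩

theorem exists_finite_representatives_of_card_le (n : ℕ) :
    ∃ S : Set ι, S.Finite ∧ ∀ i, Nat.card (G i) ≤ n → ∃ j ∈ S, Nonempty (G j ≃* G i) := by
  choose S hS hrep using exists_finite_representatives_of_card_eq G
  refine ⟨⋃ m ∈ Set.Iic n, S m, (Set.finite_Iic n).biUnion fun m _ => hS m, fun i hi => ?_⟩
  obtain ⟨j, hj, hji⟩ := hrep _ i rfl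
  exact ⟨j, Set.mem_biUnion hi hj, hji⟩

end BoundedOrder

namespace BisetFunctor

variable {k : Type v} [CommRing k] {𝒯 : FiniteGrp.{u} → Prop} {E F : BisetFunctor k 𝒯}
  {G H R : BisetCatOn k 𝒯}

instance (F : BisetFunctor k 𝒯) : F.obj.Additive := F.property.1

instance (F : BisetFunctor k 𝒯) : F.obj.Linear k := F.property.2

/-! ### Subfunctors and epimorphisms -/

theorem generated_eq_top_iff {𝒢 : Set F.Element} :
    (∀ H, (F.generated 𝒢).carrier H = ⊤) ↔
      ∀ L : F.Subfunctor, (∀ g ∈ 𝒢, g.2 ∈ L.carrier g.1) → ∀ H, L.carrier H = ⊤ := by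
  simp only [generated, Set.mem_ofPred_eq, iInf_eq_top]
  exact ⟨fun h L hL H => h H L hL, fun h H L hL => h L hL H⟩

/-- The image of a morphism of biset functors, as a subfunctor of its target. -/
def Subfunctor.range (π : E ⟶ F) : F.Subfunctor where
  carrier H := LinearMap.range (π.hom.app H).hom
  map_mem := by
    rintro G H α _ ⟨x, rfl⟩
    exact ⟨E.obj.map α x, NatTrans.naturality_apply π.hom α x⟩

/-- The quotient `F / L` of a biset functor by a subfunctor. -/
def Subfunctor.quotient (L : F.Subfunctor) : BisetFunctor k 𝒯 where
  obj :=
    { obj := fun H => ModuleCat.of k (F.obj.obj H ⧸ L.carrier H)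
      map := fun {G H} α => ModuleCat.ofHom
        ((L.carrier G).mapQ (L.carrier H) (F.obj.map α).hom fun x hx => L.map_mem α x hx)
      map_id := fun _ => ModuleCat.hom_ext (Submodule.linearMap_qext _ (by ext; simp))
      map_comp := fun _ _ => ModuleCat.hom_ext (Submodule.linearMap_qext _ (by ext; simp)) }
  property :=
    ⟨⟨fun {_ _ _ _} => ModuleCat.hom_ext (Submodule.linearMap_qext _
      (by ext; simp [F.obj.map_add]))⟩,
      ⟨fun _ _ => ModuleCat.hom_ext (Submodule.linearMap_qext _ (by ext; simp [F.obj.map_smul]))⟩⟩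

/-- The projection `F ⟶ F / L`. -/
noncomputable def Subfunctor.projection (L : F.Subfunctor) : F ⟶ L.quotient :=
  ObjectProperty.homMk { app := fun H => ModuleCat.ofHom (L.carrier H).mkQ }

theorem comp_projection_range (π : E ⟶ F) : π ≫ (Subfunctor.range π).projection = 0 := by
  ext H x
  exact (Submodule.Quotient.mk_eq_zero _).2 ⟨x, rfl⟩

theorem epi_iff_surjective (π : E ⟶ F) :
    Epi π ↔ ∀ H, Function.Surjective (π.hom.app H) := by
  refine ⟨fun hπ H y => ?_, fun h => ?_⟩
  · have hzero : (Subfunctor.range π).projection = 0 :=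
      Limits.zero_of_epi_comp π (comp_projection_range π)
    have hy : (Subfunctor.range π).projection.hom.app H y = 0 := by
      rw [hzero]
      rfl
    exact (Submodule.Quotient.mk_eq_zero _).1 hy
  · have (H : BisetCatOn k 𝒯) : Epi (π.hom.app H) := (ModuleCat.epi_iff_surjective _).2 (h H)
    have : Epi ((ObjectProperty.ι _).map π) := NatTrans.epi_of_epi_app π.hom
    exact (ObjectProperty.ι _).epi_of_epi_map this

/-! ### Direct sums of representable functors -/

/-- The morphism `kB_R ⟶ F` sending the identity of `R` to `v`, given by the Yoneda lemma. -/
noncomputable def ofElement (v : F.obj.obj R) : representable R ⟶ F :=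
  ObjectProperty.homMk
    { app := fun H => ModuleCat.ofHom
        { toFun := fun α : R ⟶ H => F.obj.map α v
          map_add' := fun α β => by simp [F.obj.map_add]
          map_smul' := fun r α => by simp [F.obj.map_smul] }
      naturality := fun G H α => by
        ext β
        exact ConcreteCategory.congr_hom (F.obj.map_comp β α) v }

theorem ofElement_apply (v : F.obj.obj R) (α : R ⟶ H) :
    (ofElement v).hom.app H α = F.obj.map α v := rfl

namespace directSum

variable {ι : Type} [DecidableEq ι] {P : ι → BisetFunctor k 𝒯}

/-- The inclusion of a summand in a direct sum of biset functors. -/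
noncomputable def of (P : ι → BisetFunctor k 𝒯) (i : ι) : P i ⟶ directSum P :=
  ObjectProperty.homMk
    { app := fun H => ModuleCat.ofHom (DirectSum.lof k ι (fun i => (P i).obj.obj H) i)
      naturality := fun G H α => by
        ext x
        exact (DirectSum.lmap_lof (R := k) (fun i => ((P i).obj.map α).hom) i x).symm }

/-- The morphism from a direct sum of biset functors with given restrictions to the summands. -/
noncomputable def desc (f : ∀ i, P i ⟶ F) : directSum P ⟶ F :=
  ObjectProperty.homMk
    { app := fun H => ModuleCat.ofHom (DirectSum.toModule k ι _ fun i => ((f i).hom.app H).hom)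
      naturality := fun G H α => by
        refine ModuleCat.hom_ext (DirectSum.linearMap_ext _ fun i => LinearMap.ext fun x => ?_)
        simp [directSum] }

theorem desc_of (f : ∀ i, P i ⟶ F) (i : ι) (x : (P i).obj.obj H) :
    (desc f).hom.app H ((of P i).hom.app H x) = (f i).hom.app H x :=
  DirectSum.toModule_lof k (φ := fun i => ((f i).hom.app H).hom) i x

end directSum

theorem epi_desc_ofElement {ι : Type} [DecidableEq ι] {v : ι → F.Element}
    (hv : ∀ H, (F.generated (Set.range v)).carrier H = ⊤) :
    Epi (directSum.desc fun i => ofElement (v i).2) := by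
  rw [epi_iff_surjective]
  refine fun H => LinearMap.range_eq_top.1
    (generated_eq_top_iff.1 hv (Subfunctor.range _) ?_ H)
  rintro _ ⟨i, rfl⟩
  refine ⟨(directSum.of _ i).hom.app _ (𝟙 (v i).1), ?_⟩
  exact (directSum.desc_of _ i _).trans (by simp [ofElement_apply])

theorem IsFinitelyGenerated.exists_epi (h : F.IsFinitelyGenerated) :
    ∃ (m : ℕ) (R : Fin m → BisetCatOn k 𝒯) (π : directSum (fun i => representable (R i)) ⟶ F),
      Epi π := by
  obtain ⟨𝒢, h𝒢, hF⟩ := h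
  obtain ⟨m, v, -, rfl⟩ := h𝒢.fin_param
  exact ⟨m, fun i => (v i).1, _, epi_desc_ofElement hF⟩

/-! ### Residues -/

theorem residueKer_le_iff {N : Submodule k (F.obj.obj H)} :
    F.residueKer H ≤ N ↔ ∀ T : BisetCatOn k 𝒯, Nat.card T.group < Nat.card H.group →
      ∀ (α : T ⟶ H) (x : F.obj.obj T), F.obj.map α x ∈ N := by
  simp only [residueKer, iSup_le_iff, LinearMap.range_le_iff_comap, Submodule.eq_top_iff',
    Submodule.mem_comap]

theorem map_mem_residueKer (h : Nat.card G.group < Nat.card H.group) (α : G ⟶ H)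
    (x : F.obj.obj G) : F.obj.map α x ∈ F.residueKer H :=
  residueKer_le_iff.1 le_rfl G h α x

theorem residueKer_le_comap_app (π : E ⟶ F) (H : BisetCatOn k 𝒯) :
    E.residueKer H ≤ (F.residueKer H).comap (π.hom.app H).hom := by
  refine residueKer_le_iff.2 fun T hT α x => ?_
  have := map_mem_residueKer hT α (π.hom.app T x)
  rwa [← NatTrans.naturality_apply] at this

theorem residueKer_le_comap_map (α : G ⟶ H) (h : Nat.card G.group ≤ Nat.card H.group) :
    F.residueKer G ≤ (F.residueKer H).comap (F.obj.map α).hom := by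
  refine residueKer_le_iff.2 fun T hT β x => ?_
  have := map_mem_residueKer (hT.trans_le h) (β ≫ α) x
  rwa [Functor.map_comp] at this

theorem residueKer_eq_top_of_epi (π : E ⟶ F) [Epi π] (h : E.residueKer H = ⊤) :
    F.residueKer H = ⊤ := by
  refine Submodule.eq_top_iff'.2 fun y => ?_
  obtain ⟨x, rfl⟩ := (epi_iff_surjective π).1 ‹_› H y
  exact residueKer_le_comap_app π H (h ▸ Submodule.mem_top)

theorem residueKer_representable (h : Nat.card R.group < Nat.card H.group) :
    (representable (k := k) R).residueKer H = ⊤ := by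
  refine Submodule.eq_top_iff'.2 fun (α : R ⟶ H) => ?_
  have := map_mem_residueKer (F := representable R) h α (𝟙 R)
  rwa [show (representable R).obj.map α (𝟙 R) = α from Category.id_comp α] at this

theorem residueKer_directSum {ι : Type} {P : ι → BisetFunctor k 𝒯}
    (h : ∀ i, (P i).residueKer H = ⊤) : (directSum P).residueKer H = ⊤ := by
  classical
  refine Submodule.eq_top_iff'.2 fun x => ?_
  induction x using DirectSum.induction_on with
  | zero => exact zero_mem _
  | of i x => exact residueKer_le_comap_app (directSum.of P i) H (h i ▸ Submodule.mem_top)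
  | add x y hx hy => exact add_mem hx hy

theorem subsingleton_residue_of_epi {ι : Type} {R : ι → BisetCatOn k 𝒯}
    (π : directSum (fun i => representable (R i)) ⟶ F) [Epi π]
    (h : ∀ i, Nat.card (R i).group < Nat.card H.group) : Subsingleton (F.Residue H) :=
  Submodule.Quotient.subsingleton_iff.2 <|
    residueKer_eq_top_of_epi π <| residueKer_directSum fun i => residueKer_representable (h i)

instance {ι : Type} [Finite ι] (P : ι → BisetFunctor k 𝒯)
    [∀ i, Module.Finite k ((P i).obj.obj H)] : Module.Finite k ((directSum P).obj.obj H) :=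
  inferInstanceAs (Module.Finite k (Π₀ i, (P i).obj.obj H))

instance : Module.Finite k ((representable R).obj.obj H) :=
  inferInstanceAs (Module.Finite k (R ⟶ H))

theorem finite_residue_of_epi (π : E ⟶ F) [Epi π] [Module.Finite k (E.obj.obj H)] :
    Module.Finite k (F.Residue H) :=
  have := Module.Finite.of_surjective _ ((epi_iff_surjective π).1 ‹_› H)
  inferInstance

/-! ### Generators of residues generate the functor -/

namespace Subfunctor

theorem sup_residueKer_eq_top_of_isSplitEpi (L : F.Subfunctor) (α : G ⟶ H) [IsSplitEpi α]
    (hcard : Nat.card G.group ≤ Nat.card H.group) (hG : L.carrier G ⊔ F.residueKer G = ⊤) :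
    L.carrier H ⊔ F.residueKer H = ⊤ := by
  have hsurj : Function.Surjective (F.obj.map α) :=
    (ModuleCat.epi_iff_surjective _).1 inferInstance
  rw [eq_top_iff, ← LinearMap.range_eq_top.2 hsurj, LinearMap.range_eq_map, ← hG, Submodule.map_sup]
  exact sup_le_sup (Submodule.map_le_iff_le_comap.2 (L.map_mem α))
    (Submodule.map_le_iff_le_comap.2 (residueKer_le_comap_map α hcard))

theorem eq_top_of_sup_residueKer_eq_top (L : F.Subfunctor)
    (h : ∀ H, L.carrier H ⊔ F.residueKer H = ⊤) (H : BisetCatOn k 𝒯) : L.carrier H = ⊤ := by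
  induction hc : Nat.card H.group using Nat.strong_induction_on generalizing H with
  | _ c ih =>
  subst hc
  rw [← h H, left_eq_sup, residueKer_le_iff]
  intro T hT α x
  exact L.map_mem α x (ih _ hT T rfl ▸ Submodule.mem_top)

end Subfunctor

theorem isFinitelyGenerated_of_residue (hfin : ∀ H, Module.Finite k (F.Residue H)) (n : ℕ)
    (hn : ∀ H : BisetCatOn k 𝒯, n < Nat.card H.group → Subsingleton (F.Residue H)) :
    F.IsFinitelyGenerated := by
  obtain ⟨S, hS, hrep⟩ :=
    exists_finite_representatives_of_card_le (fun H : BisetCatOn k 𝒯 => H.group) n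
  choose s hs hspan using fun H => exists_finite_span_sup_eq_top (F.residueKer H)
  refine ⟨⋃ G ∈ S, Sigma.mk G '' s G, hS.biUnion fun G _ => (hs G).image _,
    generated_eq_top_iff.2 fun L hL => L.eq_top_of_sup_residueKer_eq_top fun H => ?_⟩
  rcases lt_or_ge n (Nat.card H.group) with hH | hH
  · rw [Submodule.Quotient.subsingleton_iff.1 (hn H hH), sup_top_eq]
  · obtain ⟨G, hG, ⟨e⟩⟩ := hrep H hH
    let φ : G ≅ H := ObjectProperty.isoMk _ (BisetCat.isoOfMulEquiv e)
    refine L.sup_residueKer_eq_top_of_isSplitEpi φ.hom (Nat.card_congr e.toEquiv).le ?_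
    have hsL : Submodule.span k (s G) ≤ L.carrier G :=
      Submodule.span_le.2 fun x hx => hL ⟨G, x⟩ (Set.mem_biUnion hG ⟨x, hx, rfl⟩)
    exact top_le_iff.1 ((hspan G).ge.trans (sup_le_sup_right hsL _))

end BisetFunctor

theorem proposition6p2_general (k : Type v) [CommRing k] (𝒯 : FiniteGrp.{u} → Prop)
    (F : BisetFunctor.{u, v} k 𝒯) :
    List.TFAE [
      F.IsFinitelyGenerated,
      ∃ (m : ℕ) (R : Fin m → BisetCatOn k 𝒯)
        (π : BisetFunctor.directSum (fun i => BisetFunctor.representable (R i)) ⟶ F), Epi π,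
      (∀ H : BisetCatOn k 𝒯, Module.Finite k (F.Residue H)) ∧
        ∃ n : ℕ, ∀ H : BisetCatOn k 𝒯, n < Nat.card H.group → Subsingleton (F.Residue H)] := by
  tfae_have 1 → 2 := BisetFunctor.IsFinitelyGenerated.exists_epi
  tfae_have 2 → 3 := by
    rintro ⟨m, R, π, _⟩
    obtain ⟨n, hn⟩ := (Set.finite_range fun i => Nat.card (R i).group).bddAbove
    exact ⟨fun H => BisetFunctor.finite_residue_of_epi π, n, fun H hH =>
      BisetFunctor.subsingleton_residue_of_epi π fun i => (hn ⟨i, rfl⟩).trans_lt hH⟩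
  tfae_have 3 → 1 := fun ⟨hfin, n, hn⟩ => BisetFunctor.isFinitelyGenerated_of_residue hfin n hn
  tfae_finish

theorem proposition6p2 (k : Type v) [CommRing k] (𝒯 : FiniteGrp.{u} → Prop)
    (h𝒯 : ClosedUnderSubquotients 𝒯) (F : BisetFunctor.{u, v} k 𝒯) :
    List.TFAE [
      F.IsFinitelyGenerated,
      ∃ (m : ℕ) (R : Fin m → BisetCatOn k 𝒯)
        (π : BisetFunctor.directSum (fun i => BisetFunctor.representable (R i)) ⟶ F), Epi π,
      (∀ H : BisetCatOn k 𝒯, Module.Finite k (F.Residue H)) ∧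
        ∃ n : ℕ, ∀ H : BisetCatOn k 𝒯, n < Nat.card H.group → Subsingleton (F.Residue H)] :=
  proposition6p2_general k 𝒯 F
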